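/- A commutative square of simplicial sets, with top $P\to Y$, left $P\to X$, right $r:Y\to Z$ and bottom $b:X\to Z$, is a homotopy pullback diagram if, for every factorization of $r$ as a weak homotopy equivalence $Y\to Y'$ followed by a Kan fibration $Y'\to Z$, the induced morphism $P\to X\times_Z Y'$ is a weak homotopy equivalence. A commutative square of categories and functors is a homotopy pullback diagram if its image under the nerve functor is a homotopy pullback diagram of simplicial sets. Let $\mathcal{A}$ and $\mathcal{B}$ be (small) categories and let $[0]$ be the terminal category. Then the commutative square $$\begin{array}{ccc}\mathcal{A}\times\mathcal{B}&\longrightarrow&\mathcal{B}\\ \downarrow&&\downarrow\\ \mathcal{A}&\longrightarrow&[0]\end{array}$$ whose arrows are the evident projections is a homotopy pullback diagram of categories. -/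

import Mathlib

open CategoryTheory Limits

universe v u

/-!
Conventions: `SSet` is Mathlib's category of simplicial sets, `Fibration p` for the instances
opened below means that `p` is a Kan fibration (right lifting property with respect to all horn
inclusions), and `SSet.KanComplex K` means that `K` is a Kan complex.
-/

namespace HomotopyPullback

section SimplicialSets

open Simplicial HomotopicalAlgebra MonoidalCategory SSet.modelCategoryQuillen

/-- A morphism `f : X ⟶ Y` of simplicial sets is a *weak homotopy equivalence* if for every Kan
complex `K`, precomposition with `f` induces a bijection `π₀ (Fun(Y, K)) → π₀ (Fun(X, K))`, i.e.
a bijection between the sets of simplicial homotopy classes of maps `[Y, K] → [X, K]`. -/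
def IsWeakHomotopyEquiv {X Y : SSet.{u}} (f : X ⟶ Y) : Prop :=
  ∀ (K : SSet.{u}) [SSet.KanComplex K],
    Function.Bijective (SSet.mapπ₀ ((MonoidalClosed.pre f).app K))

/-- All values of a simplex of `∂Δ[1]` agree. -/
lemma asOrderHom_boundary_one {n : SimplexCategoryᵒᵖ} (s : (∂Δ[1] : SSet.{u}).obj n)
    (i : Fin (n.unop.len + 1)) :
    SSet.stdSimplex.asOrderHom s.1 i = SSet.stdSimplex.asOrderHom s.1 0 := by
  have h : ¬ Function.Surjective (SSet.stdSimplex.asOrderHom s.1) := s.2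
  by_contra hne
  apply h
  intro k
  by_cases hk : SSet.stdSimplex.asOrderHom s.1 i = k
  · exact ⟨i, hk⟩
  · exact ⟨0, by grind⟩

/-- The morphism `∂Δ[1] ⟶ E` given by two vertices of `E`. -/
noncomputable def boundaryOneDesc {E : SSet.{u}} (x y : E _⦋0⦌) : (∂Δ[1] : SSet.{u}) ⟶ E where
  app n := TypeCat.ofHom fun s ↦
    E.map (SimplexCategory.const n.unop ⦋0⦌ 0).op
      (if SSet.stdSimplex.asOrderHom s.1 0 = 0 then x else y)
  naturality := by
    intro m n f
    ext s
    have h : SSet.stdSimplex.asOrderHom ((∂Δ[1] : SSet.{u}).map f s).1 0 =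
       SSet.stdSimplex.asOrderHom s.1 0 := asOrderHom_boundary_one s (f.unop.toOrderHom 0)
    have h2 : (SimplexCategory.const m.unop ⦋0⦌ 0).op ≫ f =
      (SimplexCategory.const n.unop ⦋0⦌ 0).op := rfl
    change E.map _ (if SSet.stdSimplex.asOrderHom ((∂Δ[1] : SSet.{u}).map f s).1 0 = 0
      then x else y) = E.map f (E.map _ _)
    rw [h, ← Functor.map_comp_apply, h2]

/-- A trivial fibration induces a bijection on connected components. -/
lemma mapπ₀_bijective_of_rlp {E B : SSet.{u}} (p : E ⟶ B)
    (hp : (MorphismProperty.monomorphisms SSet.{u}).rlp p) :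
    Function.Bijective (SSet.mapπ₀ p) := by
  have key : ∀ x y : E _⦋0⦌, p.app _ x = p.app _ y → SSet.π₀.mk x = SSet.π₀.mk y := by
    intro x y h
    have hlift := hp (SSet.boundary.{u} 1).ι inferInstance
    have sq : CommSq (boundaryOneDesc x y) (SSet.boundary.{u} 1).ι p (SSet.const (p.app _ x)) := ⟨by
      ext n s
      change p.app n (E.map _ (if _ then x else y)) = B.map _ (p.app _ x)
      rw [NatTrans.naturality_apply]
      split_ifs
      · rfl
      · rw [← h]⟩
    have hl (i : Fin 2) : E.δ i (SSet.yonedaEquiv sq.lift) =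
        (boundaryOneDesc x y).app _ (SSet.yonedaEquiv (SSet.boundary.ι.{u} i)) := by
      rw [← SSet.stdSimplex.yonedaEquiv_δ_comp, ← SSet.boundary.ι_ι_assoc, sq.fac_left]
      rfl
    have hc : (SimplexCategory.const ⦋0⦌ ⦋0⦌ 0).op = 𝟙 _ :=
      congrArg Quiver.Hom.op (SimplexCategory.isTerminalZero.hom_ext _ _)
    have hid (z : E _⦋0⦌) : E.map (SimplexCategory.const ⦋0⦌ ⦋0⦌ 0).op z = z := by
      rw [hc]
      exact Functor.map_id_apply E _ z
    apply SSet.π₀.sound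
    refine SSet.Edge.mk (SSet.yonedaEquiv sq.lift) ?_ ?_
    · rw [hl]
      have h0 : SSet.stdSimplex.asOrderHom (SSet.yonedaEquiv (SSet.boundary.ι.{u} (1 : Fin 2))).1 0 = 0 := by decide
      exact (congrArg (E.map (SimplexCategory.const ⦋0⦌ ⦋0⦌ 0).op) (if_pos h0)).trans (hid x)
    · rw [hl]
      have h1 : SSet.stdSimplex.asOrderHom (SSet.yonedaEquiv (SSet.boundary.ι.{u} (0 : Fin 2))).1 0 ≠ 0 := by decide
      exact (congrArg (E.map (SimplexCategory.const ⦋0⦌ ⦋0⦌ 0).op) (if_neg h1)).trans (hid y)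
  have := hp (initial.to B) inferInstance
  have sq : CommSq (initial.to E) (initial.to B) p (𝟙 B) := ⟨initialIsInitial.hom_ext _ _⟩
  have hs : ∀ b, p.app _ (sq.lift.app (.op ⦋0⦌) b) = b := fun b ↦
    ConcreteCategory.congr_hom (NatTrans.congr_app sq.fac_right _) b
  constructor
  · intro x y h
    induction x with | mk x => 
    induction y with | mk y =>
    have h2 := congrArg (SSet.mapπ₀ sq.lift) h
    simp only [SSet.mapπ₀_mk] at h2
    rwa [key _ x (hs _), key _ y (hs _)] at h2
  · intro b
    induction b with | mk b =>
    exact ⟨.mk (sq.lift.app _ b), by simp only [SSet.mapπ₀_mk, hs]⟩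

/-- Anodyne extensions are weak homotopy equivalences. -/
lemma isWeakHomotopyEquiv_of_anodyne {X Y : SSet.{u}} (j : X ⟶ Y)
    (hj : SSet.anodyneExtensions j) : IsWeakHomotopyEquiv j := by
  intro K _
  apply mapπ₀_bijective_of_rlp
  intro A B i hi
  have : Mono i := hi
  let sq₁₂ := Functor.PushoutObjObj.ofHasPushout (curriedTensor SSet) j i
  have h := SSet.anodyneExtensions_pushoutObjObjι' sq₁₂ hj
  have h2 := (MonoidalClosed.internalHomAdjunction₂.hasLiftingProperty_iff sq₁₂
    (Functor.PullbackObjObj.ofIsTerminal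
    MonoidalClosed.internalHom j (terminal.from K) terminalIsTerminal)).1
    (h _ (by rw [← HomotopicalAlgebra.fibration_iff]; infer_instance))
  exact h2

/-- Every morphism of simplicial sets factors as a weak homotopy equivalence followed by a Kan
fibration. -/
lemma exists_factorization {Y Z : SSet.{u}} (r : Y ⟶ Z) :
    ∃ (Y' : SSet.{u}) (j : Y ⟶ Y') (p : Y' ⟶ Z),
      j ≫ p = r ∧ IsWeakHomotopyEquiv j ∧ Fibration p := by
  let d := MorphismProperty.factorizationData J.{u}.rlp.llp J.{u}.rlp r
  exact ⟨d.Z, d.i, d.p, d.fac, isWeakHomotopyEquiv_of_anodyne _ d.hi, (fibration_iff _).2 d.hp⟩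

/-- A square of simplicial sets
```
  P --t--> Y
  |        |
  l        r
  |        |
  v        v
  X --b--> Z
```
is a *homotopy pullback diagram* if it commutes and, for every factorization of `r` as a weak
homotopy equivalence `j : Y ⟶ Y'` followed by a Kan fibration `p : Y' ⟶ Z`, the induced morphism
from `P` to the strict pullback of `b` and `p` is a weak homotopy equivalence.
(Such factorizations always exist, see `exists_factorization`.) -/
structure SSetIsHomotopyPullback {P X Y Z : SSet.{u}}
    (t : P ⟶ Y) (l : P ⟶ X) (r : Y ⟶ Z) (b : X ⟶ Z) : Prop extends CommSq t l r b where
  isWeakHomotopyEquiv_lift : ∀ (Y' : SSet.{u}) (j : Y ⟶ Y') (p : Y' ⟶ Z) (fac : j ≫ p = r),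
    IsWeakHomotopyEquiv j → Fibration p →
      IsWeakHomotopyEquiv (pullback.lift (f := b) (g := p) l (t ≫ j)
        (by rw [Category.assoc, fac, w]))

end SimplicialSets

section Categories

/-- A square of categories is a *homotopy pullback diagram* if it commutes (strictly) and the
nerve functor sends it to a homotopy pullback diagram of simplicial sets. -/
structure CatIsHomotopyPullback {P X Y Z : Cat.{v, u}}
    (t : P ⟶ Y) (l : P ⟶ X) (r : Y ⟶ Z) (b : X ⟶ Z) : Prop extends CommSq t l r b where
  nerve : SSetIsHomotopyPullback (nerveFunctor.map t) (nerveFunctor.map l)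
    (nerveFunctor.map r) (nerveFunctor.map b)

end Categories

end HomotopyPullback

namespace HomotopyPullback

section SimplicialSets

open Simplicial HomotopicalAlgebra MonoidalCategory SSet.modelCategoryQuillen

/-! The nerve preserves binary products and terminal objects, so the claim is about `X × Y` over a
terminal simplicial set. For a factorization `Y ⟶ Y' ⟶ Z` with `Z` terminal, the pullback is `X ×
Y'` and the comparison map is `X ◁ j` up to isomorphism. It remains to see that `X × -` preserves
weak homotopy equivalences (`IsWeakHomotopyEquiv.whiskerLeft`). These are detected by maps into Kan
complexes `K`; by the exponential law, testing `X ◁ j` on `K` is testing `j` on `Fun(X, K)`, again a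
Kan complex. -/

lemma mapπ₀_bijective_of_iso {X Y : SSet.{u}} (e : X ≅ Y) :
    Function.Bijective (SSet.mapπ₀ e.hom) :=
  (isIso_iff_bijective (SSet.π₀Functor.map e.hom)).1 inferInstance

lemma mapπ₀_bijective_iff_of_iso {X Y X' Y' : SSet.{u}} {f : X ⟶ Y} {g : X' ⟶ Y'}
    (e : X ≅ X') (e' : Y ≅ Y') (w : f ≫ e'.hom = e.hom ≫ g) :
    Function.Bijective (SSet.mapπ₀ f) ↔ Function.Bijective (SSet.mapπ₀ g) := by
  have h : SSet.mapπ₀ e'.hom ∘ SSet.mapπ₀ f = SSet.mapπ₀ g ∘ SSet.mapπ₀ e.hom := by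
    funext x
    simp only [Function.comp_apply, ← SSet.mapπ₀_comp_apply, w]
  rw [← (mapπ₀_bijective_of_iso e').of_comp_iff', h,
    (mapπ₀_bijective_of_iso e).of_comp_iff]

lemma IsWeakHomotopyEquiv.of_isIso {X Y : SSet.{u}} (f : X ⟶ Y) [IsIso f] :
    IsWeakHomotopyEquiv f := by
  intro K _
  have : IsIso (MonoidalClosed.pre f) :=
    inferInstanceAs (IsIso (MonoidalClosed.internalHom.map f.op))
  exact mapπ₀_bijective_of_iso (asIso ((MonoidalClosed.pre f).app K))

lemma IsWeakHomotopyEquiv.comp {X Y Z : SSet.{u}} {f : X ⟶ Y} {g : Y ⟶ Z}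
    (hf : IsWeakHomotopyEquiv f) (hg : IsWeakHomotopyEquiv g) :
    IsWeakHomotopyEquiv (f ≫ g) := by
  intro K _
  have h : SSet.mapπ₀ ((MonoidalClosed.pre (f ≫ g)).app K) =
      SSet.mapπ₀ ((MonoidalClosed.pre f).app K) ∘ SSet.mapπ₀ ((MonoidalClosed.pre g).app K) := by
    funext x
    rw [MonoidalClosed.pre_map, NatTrans.comp_app, SSet.mapπ₀_comp_apply, Function.comp_apply]
  rw [h]
  exact (hf K).comp (hg K)

/-- The exponential law `Fun(Y, Fun(X, -)) ≅ Fun(X ⊗ Y, -)`. -/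
noncomputable def ihomCompIso (X Y : SSet.{u}) : ihom X ⋙ ihom Y ≅ ihom (X ⊗ Y) :=
  conjugateIsoEquiv ((ihom.adjunction Y).comp (ihom.adjunction X)) (ihom.adjunction (X ⊗ Y))
    (tensorLeftTensor X Y)

/-- Both sides are conjugate to transformations of left adjoints, where the square becomes
naturality of the associator in its middle variable. -/
lemma ihomCompIso_naturality (X : SSet.{u}) {Y Y' : SSet.{u}} (j : Y ⟶ Y') :
    Functor.whiskerLeft (ihom X) (MonoidalClosed.pre j) ≫ (ihomCompIso X Y).hom =
      (ihomCompIso X Y').hom ≫ MonoidalClosed.pre (X ◁ j) := by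
  dsimp only [ihomCompIso, MonoidalClosed.pre]
  rw [conjugateIsoEquiv_apply_hom, conjugateIsoEquiv_apply_hom, ← conjugateEquiv_whiskerRight,
    conjugateEquiv_comp, conjugateEquiv_comp]
  congr 1

/-- Weak homotopy equivalences are stable under product with a simplicial set. -/
lemma IsWeakHomotopyEquiv.whiskerLeft {Y Y' : SSet.{u}} {j : Y ⟶ Y'}
    (hj : IsWeakHomotopyEquiv j) (X : SSet.{u}) : IsWeakHomotopyEquiv (X ◁ j) := by
  intro K _
  -- The hypothesis on `j` is applied to the Kan complex `Fun(X, K)`.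
  exact (mapπ₀_bijective_iff_of_iso ((ihomCompIso X Y').app K) ((ihomCompIso X Y).app K)
    (NatTrans.congr_app (ihomCompIso_naturality X j) K)).1 (hj ((ihom X).obj K))

/-- Up to weak homotopy equivalence, a binary product is a homotopy pullback over a
terminal object. -/
lemma SSetIsHomotopyPullback.of_isTerminal {P X Y Z : SSet.{u}} (t : P ⟶ Y) (l : P ⟶ X)
    (r : Y ⟶ Z) (b : X ⟶ Z) (hZ : IsTerminal Z)
    (h : IsIso (CartesianMonoidalCategory.lift l t)) :
    SSetIsHomotopyPullback t l r b where
  w := hZ.hom_ext _ _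
  isWeakHomotopyEquiv_lift Y' j p fac hj _ := by
    have sq : IsPullback (SemiCartesianMonoidalCategory.fst X Y')
        (SemiCartesianMonoidalCategory.snd X Y') b p :=
      -- Replacing `b` and `p` by the canonical maps to `Z` turns the product cone into a pullback
      -- square.
      hZ.hom_ext (hZ.from X) b ▸ hZ.hom_ext (hZ.from Y') p ▸
        .of_is_product' (CartesianMonoidalCategory.tensorProductIsBinaryProduct X Y') hZ
    have fac' : pullback.lift (f := b) (g := p) l (t ≫ j) (hZ.hom_ext _ _) =
        CartesianMonoidalCategory.lift l t ≫ X ◁ j ≫ sq.isoPullback.hom := by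
      apply pullback.hom_ext
      · exact (pullback.lift_fst _ _ _).trans (by simp)
      · exact (pullback.lift_snd _ _ _).trans (by simp)
    rw [fac']
    exact (IsWeakHomotopyEquiv.of_isIso _).comp ((hj.whiskerLeft X).comp (.of_isIso _))

end SimplicialSets

section Categories

/-- The nerve of a terminal category is a terminal simplicial set. -/
noncomputable def nerveIsTerminal {T : Cat.{v, u}} (hT : IsTerminal T) :
    IsTerminal (nerveFunctor.obj T) := by
  -- In the chosen one-object model, any two functors into it agree definitionally.
  refine IsTerminal.ofIso ?_
    (nerveFunctor.mapIso (Cat.chosenTerminalIsTerminal.uniqueUpToIso hT))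
  have (n : SimplexCategoryᵒᵖ) : Unique ((nerveFunctor.obj Cat.chosenTerminal.{v, u}).obj n) :=
    { default := (Functor.const _).obj ⟨⟨⟨⟩⟩⟩
      uniq F := CategoryTheory.Functor.ext (fun _ ↦ rfl) (fun _ _ _ ↦ rfl) }
  exact IsTerminal.ofUniqueHom (fun X ↦ { app n := TypeCat.ofHom fun _ ↦ default })
    (fun X f ↦ by ext; exact Subsingleton.elim _ _)

/-- In degree `n`, simplices of the nerve are functors out of `[n]`, and a functor into `A × B` is a
pair of functors. -/
lemma isIso_lift_nerve_fst_snd (A B : Cat.{v, u}) :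
    IsIso (CartesianMonoidalCategory.lift
      (nerveFunctor.map (CategoryTheory.Prod.fst A B).toCatHom)
      (nerveFunctor.map (CategoryTheory.Prod.snd A B).toCatHom)) := by
  rw [NatTrans.isIso_iff_isIso_app]
  intro n
  rw [isIso_iff_bijective]
  refine ⟨fun (F : _ ⥤ A × B) (G : _ ⥤ A × B) h ↦ ?_, fun x ↦ ?_⟩
  · have h₁ : F ⋙ CategoryTheory.Prod.fst A B = G ⋙ CategoryTheory.Prod.fst A B :=
      congrArg Prod.fst h
    have h₂ : F ⋙ CategoryTheory.Prod.snd A B = G ⋙ CategoryTheory.Prod.snd A B :=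
      congrArg Prod.snd h
    exact (congrArg₂ Functor.prod' h₁ h₂ :)
  · exact ⟨Functor.prod' x.1 x.2, rfl⟩

end Categories

end HomotopyPullback

theorem mainTheorem7 (A B : Cat.{v, u}) (T : Cat.{v, u}) (hT : IsTerminal T) :
    HomotopyPullback.CatIsHomotopyPullback
      (P := Cat.of (A × B)) (X := A) (Y := B) (Z := T)
      (CategoryTheory.Prod.snd A B).toCatHom (CategoryTheory.Prod.fst A B).toCatHom (hT.from B) (hT.from A) where
  w := hT.hom_ext _ _
  nerve := .of_isTerminal _ _ _ _ (HomotopyPullback.nerveIsTerminal hT)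
    (HomotopyPullback.isIso_lift_nerve_fst_snd A B)
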